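/- Let $K$ be a field, let $k\ge 1$, and let $G$ be a cycle of length $n=2k+1$ with vertices $x_1,\dots,x_n$. Let $R=K[x_1,\dots,x_n]$, let $\mathfrak m=(x_1,\dots,x_n)$, and let $I\subset R$ be the edge ideal of $G$, i.e. the ideal generated by the monomials $x_ix_j$ with $\{x_i,x_j\}$ an edge of $G$. Write $\operatorname{Ass}(R/I^t)$ for the set of associated primes of $R/I^t$ and $\operatorname{Min}(R/I)$ for the set of minimal primes of $I$. Then: 1. $\operatorname{Ass}(R/I^t)=\operatorname{Min}(R/I)$ for all integers $1\le t\le k$; 2. $\operatorname{Ass}(R/I^t)=\operatorname{Min}(R/I)\cup\{\mathfrak m\}$ for all integers $t\ge k+1$; 3. for all $t\ge k+1$ and every edge $\{x_i,x_j\}$ of $G$, the monomial $c=\left(\prod_{l=1}^{n}x_l\right)(x_ix_j)^{t-k-1}$ has degree $2t-1$ and satisfies $\mathfrak m=(I^t:c)$. -/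

import Mathlib

/-- The edge ideal `I(G)` of a graph `G` on the vertex set `V`: the ideal of the polynomial ring
`K[x_v : v ∈ V]` generated by all monomials `x_u x_v` with `{u, v}` an edge of `G`. -/
noncomputable def edgeIdeal (K : Type*) [Field K] {V : Type*} (G : SimpleGraph V) :
    Ideal (MvPolynomial V K) :=
  Ideal.span {p | ∃ u v : V, G.Adj u v ∧ p = MvPolynomial.X u * MvPolynomial.X v}

/-! Fix a vertex `v` and cut the cycle there: what remains is a path, where weighted König duality
holds exactly. Hence once `X v` is inverted, `I ^ t` is the intersection of the `t`-th powers of the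
minimal primes avoiding `v`. These powers are primary, so an associated prime missing some variable
is minimal, and only the maximal ideal can be added (`associatedPrimes_edgeIdeal_pow_subset`). For
`t ≤ k`, a monomial outside `I ^ t` that every variable multiplies into `I ^ t` would have full
support (`ne_zero_of_X_mul_monomial_mem`). It would then be a multiple of the product of all
variables, which lies in `I ^ k`. For `t ≥ k + 1`, the monomial of part 3 has degree `2 * t - 1`,
too small for `I ^ t`. Multiplying it by `X w` closes the tour from `w` into `k + 1` edges. -/

section Algebra

open MvPolynomial

variable {K : Type*} [Field K] {V : Type*}

/-- Membership of an ideal in the associated primes of `R ⧸ J`, spelled out through colons. -/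
theorem mem_associatedPrimes_quotient_iff {R : Type*} [CommRing R] [IsNoetherianRing R]
    {J P : Ideal R} :
    P ∈ associatedPrimes R (R ⧸ J) ↔ P.IsPrime ∧ ∃ f : R, ∀ r, r ∈ P ↔ r * f ∈ J := by
  rw [AssociatedPrimes.mem_iff, isAssociatedPrime_iff]
  refine and_congr_right fun _ => ?_
  have key : ∀ f r : R, r ∈ (⊥ : Submodule R (R ⧸ J)).colon {Ideal.Quotient.mk J f} ↔
      r * f ∈ J := fun f r => by
    rw [Submodule.mem_colon_singleton, Submodule.mem_bot, Algebra.smul_def,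
      Ideal.Quotient.algebraMap_eq, ← map_mul, Ideal.Quotient.eq_zero_iff_mem]
  constructor
  · rintro ⟨x, rfl⟩
    obtain ⟨f, rfl⟩ := Ideal.Quotient.mk_surjective x
    exact ⟨f, key f⟩
  · rintro ⟨f, hf⟩
    exact ⟨Ideal.Quotient.mk J f, Ideal.ext fun r => (hf r).trans (key f r).symm⟩

/-- The minimal primes of `I` are associated primes of `R ⧸ I ^ t` for `t ≠ 0`. -/
theorem minimalPrimes_subset_associatedPrimes_quotient_pow {R : Type*} [CommRing R]
    [IsNoetherianRing R] (I : Ideal R) {t : ℕ} (ht : t ≠ 0) :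
    I.minimalPrimes ⊆ associatedPrimes R (R ⧸ I ^ t) := by
  have h := Module.associatedPrimes.minimalPrimes_annihilator_subset_associatedPrimes R (R ⧸ I ^ t)
  rwa [Ideal.annihilator_quotient, ← Ideal.radical_minimalPrimes, Ideal.radical_pow I ht,
    Ideal.radical_minimalPrimes] at h

/-! ### Monomial ideals -/

/-- An ideal of polynomials containing every monomial that occurs in one of its elements. -/
def Ideal.IsMonomialIdeal (I : Ideal (MvPolynomial V K)) : Prop :=
  ∀ f ∈ I, ∀ a ∈ f.support, monomial a (1 : K) ∈ I

theorem Ideal.IsMonomialIdeal.mul {I J : Ideal (MvPolynomial V K)} (hI : I.IsMonomialIdeal)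
    (hJ : J.IsMonomialIdeal) : (I * J).IsMonomialIdeal := by
  classical
  intro f hf
  induction hf using Submodule.mul_induction_on' with
  | mem_mul_mem g hg h hh =>
    intro a ha
    obtain ⟨b, hb, c, hc, rfl⟩ := Finset.mem_add.1 (MvPolynomial.support_mul g h ha)
    rw [show monomial (b + c) (1 : K) = monomial b 1 * monomial c 1 by simp [monomial_mul]]
    exact Ideal.mul_mem_mul (hI g hg b hb) (hJ h hh c hc)
  | add g _ h _ hg hh =>
    intro a ha
    rcases Finset.mem_union.1 (MvPolynomial.support_add ha) with h1 | h1
    · exact hg a h1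
    · exact hh a h1

theorem Ideal.IsMonomialIdeal.pow {I : Ideal (MvPolynomial V K)} (hI : I.IsMonomialIdeal) (t : ℕ) :
    (I ^ t).IsMonomialIdeal := by
  induction t with
  | zero => intro f _ a _; simp
  | succ t ih => rw [pow_succ]; exact ih.mul hI

theorem mem_of_forall_monomial_mem {I : Ideal (MvPolynomial V K)} {f : MvPolynomial V K}
    (h : ∀ a ∈ f.support, monomial a (1 : K) ∈ I) : f ∈ I := by
  rw [f.as_sum]
  refine Ideal.sum_mem _ fun a ha => ?_
  rw [show monomial a (coeff a f) = C (coeff a f) * monomial a 1 by simp [C_mul_monomial]]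
  exact Ideal.mul_mem_left _ _ (h a ha)

theorem isMonomialIdeal_edgeIdeal (G : SimpleGraph V) : (edgeIdeal K G).IsMonomialIdeal := by
  have h : edgeIdeal K G = Ideal.span ((fun s => monomial s (1 : K)) ''
      {s | ∃ u v, G.Adj u v ∧ s = Finsupp.single u 1 + Finsupp.single v 1}) := by
    unfold edgeIdeal
    congr 1
    ext p
    simp only [Set.mem_ofPred_eq, Set.mem_image]
    constructor
    · rintro ⟨u, v, huv, rfl⟩
      exact ⟨_, ⟨u, v, huv, rfl⟩, by simp [X, monomial_mul]⟩
    · rintro ⟨_, ⟨u, v, huv, rfl⟩, rfl⟩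
      exact ⟨u, v, huv, by simp [X, monomial_mul]⟩
  intro f hf a ha
  rw [h, mem_ideal_span_monomial_image] at hf ⊢
  intro b hb
  obtain rfl : b = a := by
    classical
    simpa [support_monomial] using hb
  exact hf _ ha

theorem X_mul_X_mem_edgeIdeal {G : SimpleGraph V} {u v : V} (h : G.Adj u v) :
    (X u * X v : MvPolynomial V K) ∈ edgeIdeal K G :=
  Ideal.subset_span ⟨u, v, h, rfl⟩

/-! ### Order along a set of variables -/

/-- The grading homomorphism that multiplies the variables in `C` by a new variable. -/
noncomputable def scaleVars (K : Type*) [Field K] (C : Set V) :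
    MvPolynomial V K →+* Polynomial (MvPolynomial V K) := by
  classical
  exact eval₂Hom (Polynomial.C.comp MvPolynomial.C)
    fun v => if v ∈ C then Polynomial.C (X v) * Polynomial.X else Polynomial.C (X v)

/-- The polynomials all of whose monomials have degree at least `t` in the variables of `C`. -/
noncomputable def orderIdeal (K : Type*) [Field K] (C : Set V) (t : ℕ) :
    Ideal (MvPolynomial V K) :=
  (Ideal.span {Polynomial.X ^ t}).comap (scaleVars K C)

theorem mem_orderIdeal {C : Set V} {t : ℕ} {f : MvPolynomial V K} :
    f ∈ orderIdeal K C t ↔ Polynomial.X ^ t ∣ scaleVars K C f := by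
  rw [orderIdeal, Ideal.mem_comap, Ideal.mem_span_singleton]

theorem X_mem_orderIdeal {C : Set V} {v : V} (hv : v ∈ C) :
    (X v : MvPolynomial V K) ∈ orderIdeal K C 1 := by
  classical
  rw [mem_orderIdeal]
  simp [scaleVars, hv]

theorem orderIdeal_pow_le (C : Set V) (t : ℕ) :
    orderIdeal K C 1 ^ t ≤ orderIdeal K C t := by
  refine (Ideal.le_comap_pow _ _).trans ?_
  rw [orderIdeal, Ideal.span_singleton_pow, pow_one]

theorem edgeIdeal_pow_le_orderIdeal {G : SimpleGraph V} {C : Set V} (hC : G.IsVertexCover C)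
    (t : ℕ) : edgeIdeal K G ^ t ≤ orderIdeal K C t := by
  refine (Ideal.pow_right_mono ?_ t).trans (orderIdeal_pow_le C t)
  refine Ideal.span_le.2 ?_
  rintro _ ⟨u, v, huv, rfl⟩
  rcases hC huv with h | h
  · exact Ideal.mul_mem_right _ _ (X_mem_orderIdeal h)
  · exact Ideal.mul_mem_left _ _ (X_mem_orderIdeal h)

theorem scaleVars_monomial [Fintype V] (C : Finset V) (a : V →₀ ℕ) (r : K) :
    scaleVars K (C : Set V) (monomial a r) =
      Polynomial.C (monomial a r) * Polynomial.X ^ (∑ v ∈ C, a v) := by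
  classical
  have h : ∏ v ∈ C, (Polynomial.X : Polynomial (MvPolynomial V K)) ^ a v =
      ∏ v, if v ∈ C then (Polynomial.X : Polynomial (MvPolynomial V K)) ^ a v else 1 := by
    simp [Finset.prod_ite_mem]
  rw [scaleVars, coe_eval₂Hom, eval₂_monomial, monomial_eq (s := a),
    Finsupp.prod_fintype _ _ (by simp), Finsupp.prod_fintype _ _ (by simp), map_mul, map_prod,
    ← Finset.prod_pow_eq_pow_sum, mul_assoc, h, ← Finset.prod_mul_distrib, RingHom.comp_apply]
  congr 1
  refine Finset.prod_congr rfl fun v _ => ?_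
  by_cases hv : v ∈ C <;> simp [hv, mul_pow]

theorem mem_orderIdeal_iff [Fintype V] {C : Finset V} {t : ℕ} {f : MvPolynomial V K} :
    f ∈ orderIdeal K (C : Set V) t ↔ ∀ a ∈ f.support, t ≤ ∑ v ∈ C, a v := by
  classical
  -- The coefficient of `X ^ n` is the part of `f` of degree `n` in the variables of `C`.
  have key : ∀ (n : ℕ) (a : V →₀ ℕ), coeff a ((scaleVars K (C : Set V) f).coeff n) =
      if n = ∑ v ∈ C, a v then coeff a f else 0 := by
    intro n a
    induction f using MvPolynomial.induction_on' with
    | monomial b r =>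
      rw [scaleVars_monomial, Polynomial.coeff_C_mul_X_pow, coeff_monomial]
      by_cases hab : b = a
      · subst hab
        split_ifs <;> simp_all
      · split_ifs <;> simp [hab]
    | add f g hf hg =>
      rw [map_add, Polynomial.coeff_add, coeff_add, hf, hg, coeff_add]
      split_ifs <;> simp
  rw [mem_orderIdeal, Polynomial.X_pow_dvd_iff]
  constructor
  · intro h a ha
    by_contra! hlt
    have := key (∑ v ∈ C, a v) a
    rw [h _ hlt, if_pos rfl] at this
    exact mem_support_iff.1 ha (by simpa using this.symm)
  · intro h n hn
    ext a
    rw [key, coeff_zero]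
    split_ifs with h1
    · by_contra h2
      have := h a (mem_support_iff.2 h2)
      omega
    · rfl

/-- The powers of a prime generated by variables are primary. -/
theorem mem_orderIdeal_of_mul_mem {C : Set V} {t : ℕ} {g f : MvPolynomial V K}
    (h : g * f ∈ orderIdeal K C t) (hf : f ∉ orderIdeal K C t) :
    g ∈ orderIdeal K C 1 := by
  rw [mem_orderIdeal] at *
  by_contra hg
  rw [map_mul] at h
  -- The new variable is prime: if it does not divide the image of `g`, all of `X ^ t` divides that
  -- of `f`.
  exact hf (Polynomial.prime_X.pow_dvd_of_dvd_mul_left t (by simpa using hg) h)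

theorem orderIdeal_one [Fintype V] (C : Finset V) :
    orderIdeal K (C : Set V) 1 = Ideal.span (X '' (C : Set V)) := by
  ext f
  rw [mem_orderIdeal_iff, mem_ideal_span_X_image]
  refine forall₂_congr fun a _ => ?_
  rw [Nat.one_le_iff_ne_zero, Ne, Finset.sum_eq_zero_iff]
  simp

end Algebra

/-! ### König duality on paths and cut cycles -/

section PathCover

open MvPolynomial

variable {K : Type*} [Field K] {V : Type*}

/-- König's theorem for weighted paths, in terms of edge ideals: the monomial with exponents `a`
lies in the power of the edge ideal given by the weight of some vertex cover of the path,
described by its indicator function `c`. -/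
theorem exists_cover_prod_pow_mem {G : SimpleGraph V} (m : ℕ) (p : ℕ → V)
    (hp : ∀ i, G.Adj (p i) (p (i + 1))) (a : ℕ → ℕ) :
    ∃ c : ℕ → ℕ, (∀ i, c i ≤ 1) ∧ (∀ i < m, c i = 1 ∨ c (i + 1) = 1) ∧
      ∏ i ∈ Finset.range (m + 1), (X (p i) : MvPolynomial V K) ^ a i ∈
        edgeIdeal K G ^ ∑ i ∈ Finset.range (m + 1), c i * a i := by
  induction m generalizing p a with
  | zero => exact ⟨0, by simp, by simp, by simp⟩
  | succ m ih =>
    -- Greedy matching: use the first edge as often as possible, then recurse on the rest with the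
    -- reduced weight at `p 1`.
    obtain ⟨c', hc1, hcov, hmem⟩ := ih (fun i => p (i + 1)) (fun i => hp (i + 1))
      (fun i => if i = 0 then a 1 - min (a 0) (a 1) else a (i + 1))
    set e := min (a 0) (a 1) with he
    set A := ∑ i ∈ Finset.range m, c' (i + 1) * a (i + 1 + 1) with hA
    have hmem2 : ∏ i ∈ Finset.range (m + 1 + 1), (X (p i) : MvPolynomial V K) ^ a i ∈
        edgeIdeal K G ^ (A + c' 0 * (a 1 - e) + e) := by
      have h0 : a 0 = (a 0 - e) + e := by omega
      have h1 : a 1 = (a 1 - e) + e := by omega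
      have h2 := Ideal.mul_mem_mul hmem (Ideal.pow_mem_pow (X_mul_X_mem_edgeIdeal (K := K) (hp 0)) e)
      rw [← pow_add, Finset.sum_range_succ', Finset.prod_range_succ'] at h2
      simp only [Nat.add_eq_zero_iff, one_ne_zero, and_false, if_false, if_true] at h2
      have h3 := Ideal.mul_mem_left _ (X (p 0) ^ (a 0 - e)) h2
      convert h3 using 1
      rw [Finset.prod_range_succ', Finset.prod_range_succ']
      nth_rw 1 [h0]
      nth_rw 1 [zero_add, h1]
      simp only [pow_add, mul_pow, zero_add]
      ring
    rcases le_or_gt (a 1) (a 0) with hle | hlt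
    -- The residual weight at `p 1` is zero, so putting `p 1` in the cover costs exactly `e`.
    · refine ⟨fun i => match i with | 0 => 0 | 1 => 1 | i + 2 => c' (i + 1), ?_, ?_, ?_⟩
      · rintro (_ | _ | i) <;> simp [hc1]
      · rintro (_ | _ | i) hi
        · simp
        · simp
        · exact hcov (i + 1) (by omega)
      · refine Ideal.pow_le_pow_right ?_ hmem2
        rw [Finset.sum_range_succ', Finset.sum_range_succ']
        have : e = a 1 := by omega
        simp [this, hA]
    -- Exactly one of `p 0`, `p 1` is taken, and either choice pays for the `e` removed edges.
    · refine ⟨fun i => match i with | 0 => 1 - c' 0 | i + 1 => c' i, ?_, ?_, ?_⟩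
      · rintro (_ | i) <;> simp [hc1]
      · rintro (_ | i) hi
        · have := hc1 0
          simp only []
          omega
        · exact hcov i (by omega)
      · refine Ideal.pow_le_pow_right ?_ hmem2
        rw [Finset.sum_range_succ', Finset.sum_range_succ']
        have h4 : e = a 0 := by omega
        have h5 := hc1 0
        simp only [zero_add, ← hA, h4]
        interval_cases c' 0 <;> omega

/-- A product of an even number of consecutive vertices of a walk. -/
theorem prod_range_mem_edgeIdeal_pow {G : SimpleGraph V} (p : ℕ → V)
    (hp : ∀ i, G.Adj (p i) (p (i + 1))) (m : ℕ) :
    ∏ i ∈ Finset.range (2 * m), (X (p i) : MvPolynomial V K) ∈ edgeIdeal K G ^ m := by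
  induction m with
  | zero => simp
  | succ m ih =>
    rw [show 2 * (m + 1) = 2 * m + 1 + 1 by ring, Finset.prod_range_succ, Finset.prod_range_succ,
      mul_assoc, pow_succ]
    exact Ideal.mul_mem_mul ih (X_mul_X_mem_edgeIdeal (hp _))

/-- The walk `p` starts at `v`, runs once through all vertices of `G`, uses all edges of `G`, and
is back at `v` after `n` steps. -/
structure SimpleGraph.IsCyclicWalk (G : SimpleGraph V) (n : ℕ) (v : V) (p : ℕ → V) : Prop where
  adj : ∀ i, G.Adj (p i) (p (i + 1))
  start : p 0 = v
  closes : p n = v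
  bijOn : Set.BijOn p (Set.Iio n) Set.univ
  exists_of_adj : ∀ a b, G.Adj a b →
    ∃ i < n, (a = p i ∧ b = p (i + 1)) ∨ (b = p i ∧ a = p (i + 1))

open Fin.NatCast Fin.CommRing in
theorem SimpleGraph.exists_isCyclicWalk {G : SimpleGraph V} {n : ℕ}
    (φ : G ≃g SimpleGraph.cycleGraph (n + 2)) (v : V) : ∃ p, G.IsCyclicWalk (n + 2) v p := by
  have hstep : ∀ (i : ℕ), ((i + 1 : ℕ) : Fin (n + 2)) = (i : Fin (n + 2)) + 1 := by simp
  have hval : ∀ x : Fin (n + 2), ((x.val : ℕ) : Fin (n + 2)) = x := fun x => by simp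
  refine ⟨fun i => φ.symm (φ v + (i : Fin (n + 2))), ?_, by simp, ?_, ⟨fun _ _ => trivial, ?_, ?_⟩, ?_⟩
  · intro i
    rw [← φ.map_adj_iff]
    simp [SimpleGraph.cycleGraph_adj]
  · have : ((n + 2 : ℕ) : Fin (n + 2)) = 0 := by simp
    simp only [this]; simp
  · intro i hi j hj hij
    have h := φ.symm.injective hij
    have h := add_left_cancel h
    have := congrArg Fin.val h
    simpa [Fin.val_natCast, Nat.mod_eq_of_lt (Set.mem_Iio.1 hi),
      Nat.mod_eq_of_lt (Set.mem_Iio.1 hj)] using this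
  · intro w _
    refine ⟨(φ w - φ v).val, (φ w - φ v).isLt, ?_⟩
    simp only [hval]; simp
  · intro a b hab
    rw [← φ.map_adj_iff, SimpleGraph.cycleGraph_adj] at hab
    rcases hab with h | h
    · refine ⟨(φ b - φ v).val, (φ b - φ v).isLt, Or.inr ⟨?_, ?_⟩⟩
      · simp only [hval]; simp
      · simp only [hstep, hval]
        rw [← h]; simp
    · refine ⟨(φ a - φ v).val, (φ a - φ v).isLt, Or.inl ⟨?_, ?_⟩⟩
      · simp only [hval]; simp
      · simp only [hstep, hval]
        rw [← h]; simp

theorem SimpleGraph.IsCyclicWalk.prod_univ [Fintype V] {G : SimpleGraph V} {n : ℕ} {v : V}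
    {p : ℕ → V} (h : G.IsCyclicWalk n v p) {M : Type*} [CommMonoid M] (g : V → M) :
    ∏ i ∈ Finset.range n, g (p i) = ∏ w, g w :=
  Finset.prod_bij (fun i _ => p i) (fun _ _ => Finset.mem_univ _)
    (fun i hi j hj hij => h.bijOn.injOn (by simpa using hi) (by simpa using hj) hij)
    (fun w _ => by
      obtain ⟨i, hi, rfl⟩ := h.bijOn.surjOn (Set.mem_univ w)
      exact ⟨i, by simpa using hi, rfl⟩)
    (fun _ _ => rfl)

/-- Cutting a cycle at `v` and applying the path case. -/
theorem SimpleGraph.IsCyclicWalk.exists_cover [Fintype V] [DecidableEq V] {G : SimpleGraph V}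
    {n : ℕ} {v : V} {p : ℕ → V} (h : G.IsCyclicWalk (n + 1) v p) (a : V →₀ ℕ) (N : ℕ) :
    ∃ (C : Finset V) (c : ℕ), v ∉ C ∧ G.IsVertexCover (insert v C : Finset V) ∧
      (c = 0 → G.IsVertexCover (C : Set V)) ∧
      X v ^ (2 * N) * monomial a (1 : K) ∈ edgeIdeal K G ^ (c * N + ∑ w ∈ C, a w) := by
  -- Both ends of the cut walk are copies of `v`; each gets weight `N`, and the other vertices keep
  -- their exponents.
  obtain ⟨c, hc1, hcov, hmem⟩ := exists_cover_prod_pow_mem (K := K) (n + 1) p h.adj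
    (fun i => if i = 0 ∨ i = n + 1 then N else a (p i))
  have hinj : Set.InjOn (fun i => p (i + 1))
      ((Finset.range n).filter fun i => c (i + 1) = 1 : Finset ℕ) := by
    intro i hi j hj hij
    simp only [Finset.coe_filter, Finset.mem_range, Set.mem_ofPred_eq] at hi hj
    have := h.bijOn.injOn (Set.mem_Iio.2 (by omega)) (Set.mem_Iio.2 (by omega)) hij
    omega
  have hC : ∀ i, 0 < i → i < n + 1 → c i = 1 →
      p i ∈ ((Finset.range n).filter fun i => c (i + 1) = 1).image (fun i => p (i + 1)) := by
    intro i h0 h1 h2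
    obtain ⟨j, rfl⟩ := Nat.exists_eq_succ_of_ne_zero h0.ne'
    exact Finset.mem_image.2 ⟨j, by simp; exact ⟨by omega, h2⟩, rfl⟩
  have hadj : ∀ D : Finset V, (∀ i < n + 1, p i ∈ D ∨ p (i + 1) ∈ D) →
      G.IsVertexCover (D : Set V) := by
    intro D hD x y hxy
    obtain ⟨i, hi, ⟨rfl, rfl⟩ | ⟨rfl, rfl⟩⟩ := h.exists_of_adj x y hxy
    · exact hD i hi
    · exact (hD i hi).symm
  refine ⟨((Finset.range n).filter fun i => c (i + 1) = 1).image (fun i => p (i + 1)),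
    c 0 + c (n + 1), ?_, ?_, ?_, ?_⟩
  · intro hv
    obtain ⟨i, hi, hiv⟩ := Finset.mem_image.1 hv
    simp only [Finset.mem_filter, Finset.mem_range] at hi
    have := h.bijOn.injOn (Set.mem_Iio.2 (by omega)) (Set.mem_Iio.2 (by omega))
      (hiv.trans h.start.symm)
    omega
  · apply hadj
    have : ∀ i ≤ n + 1, c i = 1 → p i ∈ insert v
        (((Finset.range n).filter fun i => c (i + 1) = 1).image (fun i => p (i + 1))) := by
      intro i hi hci
      rw [Finset.mem_insert]
      rcases Nat.eq_zero_or_pos i with rfl | h0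
      · exact Or.inl h.start
      rcases hi.lt_or_eq with h1 | rfl
      · exact Or.inr (hC i h0 h1 hci)
      · exact Or.inl h.closes
    intro i hi
    exact (hcov i hi).imp (this i hi.le) (this (i + 1) hi)
  · intro hc
    apply hadj
    have : ∀ i ≤ n + 1, c i = 1 → p i ∈
        (((Finset.range n).filter fun i => c (i + 1) = 1).image (fun i => p (i + 1))) := by
      intro i hi hci
      rcases Nat.eq_zero_or_pos i with rfl | h0
      · omega
      rcases hi.lt_or_eq with h1 | rfl
      · exact hC i h0 h1 hci
      · omega
    intro i hi
    exact (hcov i hi).imp (this i hi.le) (this (i + 1) hi)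
  · have hsum : ∑ i ∈ Finset.range (n + 1 + 1),
        c i * (if i = 0 ∨ i = n + 1 then N else a (p i)) = (c 0 + c (n + 1)) * N +
        ∑ w ∈ ((Finset.range n).filter fun i => c (i + 1) = 1).image (fun i => p (i + 1)), a w := by
      rw [Finset.sum_image hinj, Finset.sum_filter, Finset.sum_range_succ,
        Finset.sum_range_succ']
      have : ∀ i ∈ Finset.range n,
          c (i + 1) * (if i + 1 = 0 ∨ i + 1 = n + 1 then N else a (p (i + 1))) =
          if c (i + 1) = 1 then a (p (i + 1)) else 0 := by
        intro i hi
        rw [Finset.mem_range] at hi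
        rw [if_neg (by omega)]
        have := hc1 (i + 1)
        interval_cases c (i + 1) <;> simp
      rw [Finset.sum_congr rfl this]
      simp
      ring
    rw [hsum] at hmem
    have hprod : X v ^ (2 * N) * monomial a (1 : K) = X v ^ (a v) *
        ∏ i ∈ Finset.range (n + 1 + 1),
          (X (p i) : MvPolynomial V K) ^ (if i = 0 ∨ i = n + 1 then N else a (p i)) := by
      rw [monomial_eq, Finsupp.prod_fintype _ _ (by simp), C_1, one_mul,
        ← h.prod_univ (fun w => (X w : MvPolynomial V K) ^ a w), Finset.prod_range_succ',
        Finset.prod_range_succ, Finset.prod_range_succ']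
      have : ∀ i ∈ Finset.range n, (X (p (i + 1)) : MvPolynomial V K) ^
          (if i + 1 = 0 ∨ i + 1 = n + 1 then N else a (p (i + 1))) =
          X (p (i + 1)) ^ a (p (i + 1)) := by
        intro i hi
        rw [Finset.mem_range] at hi
        rw [if_neg (by omega)]
      rw [Finset.prod_congr rfl this]
      simp only [h.start, h.closes, true_or, or_true, if_true]
      ring
    rw [hprod]
    exact Ideal.mul_mem_left _ _ hmem

end PathCover

/-! ### Associated primes of powers for cycles -/

section OddCycle

open MvPolynomial

variable {K : Type*} [Field K] {V : Type*} {G : SimpleGraph V}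

theorem exists_minimal_isVertexCover_subset {C : Finset V} (hC : G.IsVertexCover (C : Set V)) :
    ∃ D ⊆ C, Minimal (fun D : Finset V => G.IsVertexCover (D : Set V)) D := by
  obtain ⟨D, hDC, hD⟩ := exists_minimal_le_of_wellFoundedLT
    (fun D : Finset V => G.IsVertexCover (D : Set V)) C hC
  exact ⟨D, hDC, hD⟩

/-- The variables in a prime between the edge ideal and this one form a vertex cover inside `C`,
hence all of `C`. -/
theorem span_X_mem_minimalPrimes {C : Finset V}
    (hC : Minimal (fun D : Finset V => G.IsVertexCover (D : Set V)) C)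
    (hP : (Ideal.span (X '' (C : Set V)) : Ideal (MvPolynomial V K)).IsPrime) :
    Ideal.span (X '' (C : Set V)) ∈ (edgeIdeal K G).minimalPrimes := by
  classical
  refine ⟨⟨hP, ?_⟩, fun Q hQ hQP => ?_⟩
  · refine Ideal.span_le.2 ?_
    rintro _ ⟨u, v, huv, rfl⟩
    rcases hC.1 huv with h | h
    · exact Ideal.mul_mem_right _ _ (Ideal.subset_span ⟨u, h, rfl⟩)
    · exact Ideal.mul_mem_left _ _ (Ideal.subset_span ⟨v, h, rfl⟩)
  · have hD : G.IsVertexCover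
        (C.filter fun v => (X v : MvPolynomial V K) ∈ Q : Finset V) := by
      have hQC : ∀ v, (X v : MvPolynomial V K) ∈ Q → v ∈ C := by
        intro v hv
        have := mem_ideal_span_X_image.1 (hQP hv) (Finsupp.single v 1) (by simp)
        obtain ⟨i, hi, hne⟩ := this
        obtain rfl : v = i := by
          by_contra hvi
          exact hne (Finsupp.single_eq_of_ne (Ne.symm hvi))
        exact hi
      intro u v huv
      rcases hQ.1.mem_or_mem (hQ.2 (X_mul_X_mem_edgeIdeal (K := K) huv)) with h | h
      · exact Or.inl (by simp [h, hQC u h])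
      · exact Or.inr (by simp [h, hQC v h])
    have := hC.2 hD (Finset.filter_subset _ _)
    refine Ideal.span_le.2 ?_
    rintro _ ⟨v, hv, rfl⟩
    exact (Finset.mem_filter.1 (this hv)).2

theorem edgeIdeal_pow_le_idealOfVars_pow (t : ℕ) :
    edgeIdeal K G ^ t ≤ idealOfVars V K ^ (2 * t) := by
  rw [pow_mul]
  refine Ideal.pow_right_mono (Ideal.span_le.2 ?_) t
  rintro _ ⟨u, v, -, rfl⟩
  rw [pow_two]
  exact Ideal.mul_mem_mul (Ideal.subset_span ⟨u, rfl⟩) (Ideal.subset_span ⟨v, rfl⟩)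

theorem idealOfVars_isMaximal : (idealOfVars V K).IsMaximal := by
  have h : idealOfVars V K = RingHom.ker (constantCoeff : MvPolynomial V K →+* K) := by
    ext f
    rw [← pow_one (idealOfVars V K), mem_pow_idealOfVars_iff', RingHom.mem_ker,
      constantCoeff_eq]
    simp [Finsupp.degree_eq_zero_iff]
  rw [h]
  exact RingHom.ker_isMaximal_of_surjective _ fun r => ⟨C r, by simp⟩

variable [Fintype V]

/-- After inverting the variable `X v` of a cycle, powers of the edge ideal agree with symbolic
powers. -/
theorem X_pow_mul_mem_of_forall_mem_orderIdeal {n : ℕ} {v : V} {p : ℕ → V}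
    (h : G.IsCyclicWalk (n + 1) v p) {t : ℕ} {f : MvPolynomial V K}
    (hf : ∀ C : Finset V, Minimal (fun D : Finset V => G.IsVertexCover (D : Set V)) C → v ∉ C →
      f ∈ orderIdeal K (C : Set V) t) :
    X v ^ (2 * t) * f ∈ edgeIdeal K G ^ t := by
  classical
  rw [mul_comm]
  refine Submodule.mem_colon_singleton.1 (?_ :
    f ∈ (edgeIdeal K G ^ t).colon {(X v : MvPolynomial V K) ^ (2 * t)})
  refine mem_of_forall_monomial_mem fun a ha => Submodule.mem_colon_singleton.2 ?_
  rw [smul_eq_mul, mul_comm]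
  -- With `N = t`, a cover using an end of the cut walk already has weight `t`; otherwise it covers
  -- the cycle without `v` and `hf` applies.
  obtain ⟨C, c, hvC, -, hC, hmem⟩ := h.exists_cover (K := K) a t
  refine Ideal.pow_le_pow_right ?_ hmem
  rcases Nat.eq_zero_or_pos c with rfl | hc
  · obtain ⟨D, hDC, hD⟩ := exists_minimal_isVertexCover_subset (hC rfl)
    have h1 := mem_orderIdeal_iff.1 (hf D hD fun hv => hvC (hDC hv)) a ha
    have h2 := Finset.sum_le_sum_of_subset (f := a) hDC
    omega
  · exact (Nat.le_mul_of_pos_left t hc).trans (Nat.le_add_right _ _)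

/-- Associated primes of powers of the edge ideal of a cycle that omit some variable are minimal. -/
theorem mem_minimalPrimes_of_X_notMem {n : ℕ} {v : V} {p : ℕ → V}
    (h : G.IsCyclicWalk (n + 1) v p) {t : ℕ} {P : Ideal (MvPolynomial V K)}
    (hP : P ∈ associatedPrimes (MvPolynomial V K) (MvPolynomial V K ⧸ edgeIdeal K G ^ t))
    (hv : X v ∉ P) : P ∈ (edgeIdeal K G).minimalPrimes := by
  classical
  obtain ⟨hPp, f, hf⟩ := mem_associatedPrimes_quotient_iff.1 hP
  set S : Finset (Finset V) := Finset.univ.filter fun C =>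
    Minimal (fun D : Finset V => G.IsVertexCover (D : Set V)) C ∧ v ∉ C with hS
  have hinf : S.inf (fun C => (orderIdeal K (C : Set V) t).colon {f}) ≤ P := by
    intro g hg
    rw [Submodule.mem_finsetInf] at hg
    have h1 := X_pow_mul_mem_of_forall_mem_orderIdeal h (f := g * f) (t := t) fun C hC hvC => by
      simpa using Submodule.mem_colon_singleton.1 (hg C (by simp [hS, hC, hvC]))
    rw [← mul_assoc, ← hf] at h1
    exact (hPp.mem_or_mem h1).resolve_left fun h2 => hv (hPp.mem_of_pow_mem _ h2)
  -- A prime containing a finite intersection contains one of its members.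
  obtain ⟨C, hCS, hCP⟩ := hPp.inf_le'.1 hinf
  obtain ⟨-, hC, -⟩ := Finset.mem_filter.1 hCS
  have hfC : f ∉ orderIdeal K (C : Set V) t := fun hfC =>
    hPp.ne_top ((Ideal.eq_top_iff_one _).2 (hCP (Submodule.mem_colon_singleton.2 (by simpa))))
  have hPC : P = Ideal.span (X '' (C : Set V)) := by
    apply le_antisymm
    · intro g hg
      rw [← orderIdeal_one]
      exact mem_orderIdeal_of_mul_mem
        (edgeIdeal_pow_le_orderIdeal hC.1 t ((hf g).1 hg)) hfC
    · refine Ideal.span_le.2 ?_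
      rintro _ ⟨w, hw, rfl⟩
      refine hPp.mem_of_pow_mem t (hCP (Submodule.mem_colon_singleton.2 ?_))
      exact Ideal.mul_mem_right _ _ (orderIdeal_pow_le _ t
        (Ideal.pow_mem_pow (X_mem_orderIdeal hw) t))
  rw [hPC] at hPp ⊢
  exact span_X_mem_minimalPrimes hC hPp

theorem associatedPrimes_edgeIdeal_pow_subset {n : ℕ}
    (h : ∀ v, ∃ p, G.IsCyclicWalk (n + 1) v p) (t : ℕ) :
    associatedPrimes (MvPolynomial V K) (MvPolynomial V K ⧸ edgeIdeal K G ^ t) ⊆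
      (edgeIdeal K G).minimalPrimes ∪ {idealOfVars V K} := by
  intro P hP
  by_cases hv : ∃ v, X v ∉ P
  · obtain ⟨v, hv⟩ := hv
    obtain ⟨p, hp⟩ := h v
    exact Or.inl (mem_minimalPrimes_of_X_notMem hp hP hv)
  · push Not at hv
    refine Or.inr (idealOfVars_isMaximal.eq_of_le hP.isPrime.ne_top ?_).symm
    refine Ideal.span_le.2 ?_
    rintro _ ⟨v, rfl⟩
    exact hv v

theorem prod_X_mem_edgeIdeal_pow {k : ℕ} {v : V} {p : ℕ → V}
    (h : G.IsCyclicWalk (2 * k + 1) v p) :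
    ∏ w, (X w : MvPolynomial V K) ∈ edgeIdeal K G ^ k := by
  rw [← h.prod_univ, Finset.prod_range_succ]
  exact Ideal.mul_mem_right _ _ (prod_range_mem_edgeIdeal_pow p h.adj k)

theorem X_mul_prod_X_mem_edgeIdeal_pow {k : ℕ} {v : V} {p : ℕ → V}
    (h : G.IsCyclicWalk (2 * k + 1) v p) :
    X v * ∏ w, (X w : MvPolynomial V K) ∈ edgeIdeal K G ^ (k + 1) := by
  have := prod_range_mem_edgeIdeal_pow (K := K) p h.adj (k + 1)
  rwa [show 2 * (k + 1) = 2 * k + 1 + 1 by ring, Finset.prod_range_succ, h.prod_univ, h.closes,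
    mul_comm] at this

theorem prod_X_dvd_monomial {a : V →₀ ℕ} (ha : ∀ v, a v ≠ 0) :
    ∏ w, (X w : MvPolynomial V K) ∣ monomial a 1 := by
  rw [monomial_eq, Finsupp.prod_fintype _ _ (by simp), C_1, one_mul]
  exact Finset.prod_dvd_prod_of_dvd _ _ fun v _ => dvd_pow_self _ (ha v)

/-- A monomial outside a power of the edge ideal of a cycle that all variables multiply into
this power involves all variables. -/
theorem ne_zero_of_X_mul_monomial_mem {n : ℕ} {v : V} {p : ℕ → V}
    (h : G.IsCyclicWalk (n + 1) v p) {t : ℕ} {a : V →₀ ℕ}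
    (ha : monomial a (1 : K) ∉ edgeIdeal K G ^ t)
    (hX : ∀ w, X w * monomial a (1 : K) ∈ edgeIdeal K G ^ t) : a v ≠ 0 := by
  classical
  intro hav
  -- With `N = 0` the ends are free, and since `a v = 0`, adding `v` to `C` costs nothing.
  obtain ⟨C, c, hvC, hC, -, hmem⟩ := h.exists_cover (K := K) a 0
  have hlt : ∑ w ∈ insert v C, a w < t := by
    rw [Finset.sum_insert hvC, hav, zero_add]
    by_contra! hle
    refine ha (Ideal.pow_le_pow_right hle ?_)
    simpa using hmem
  -- A missed vertex `u` gives the contradiction: multiplying by `X u` leaves the order along `D`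
  -- below `t`.
  have hcover : ∃ D : Finset V, G.IsVertexCover (D : Set V) ∧ ∑ w ∈ D, a w < t ∧
      ∃ u, u ∉ D := by
    by_cases hu : ∃ u, u ∉ insert v C
    · exact ⟨_, hC, hlt, hu⟩
    · push Not at hu
      refine ⟨Finset.univ.erase v, fun x y hxy => ?_,
        (Finset.sum_le_sum_of_subset fun x _ => hu x).trans_lt hlt, v, by simp⟩
      by_cases hx : x = v
      · right
        simpa [← hx] using hxy.ne'
      · left
        simpa using hx
  obtain ⟨D, hD, hDt, u, hu⟩ := hcover
  have h1 := mem_orderIdeal_iff.1 (edgeIdeal_pow_le_orderIdeal hD t (hX u))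
    (Finsupp.single u 1 + a) (by simp [X, monomial_mul])
  have h2 : ∑ w ∈ D, (Finsupp.single u 1 + a : V →₀ ℕ) w = ∑ w ∈ D, a w := by
    refine Finset.sum_congr rfl fun w hw => ?_
    have : w ≠ u := fun hwu => hu (hwu ▸ hw)
    simp [Finsupp.single_eq_of_ne this]
  omega

theorem idealOfVars_notMem_associatedPrimes [Nonempty V] {k : ℕ}
    (h : ∀ v, ∃ p, G.IsCyclicWalk (2 * k + 1) v p) {t : ℕ} (ht : t ≤ k) :
    idealOfVars V K ∉
      associatedPrimes (MvPolynomial V K) (MvPolynomial V K ⧸ edgeIdeal K G ^ t) := by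
  intro hm
  obtain ⟨hp, f, hf⟩ := mem_associatedPrimes_quotient_iff.1 hm
  have hfI : f ∉ edgeIdeal K G ^ t := fun hfI =>
    hp.ne_top ((Ideal.eq_top_iff_one _).2 ((hf 1).2 (by simpa)))
  obtain ⟨a, haf, ha⟩ : ∃ a ∈ f.support, monomial a (1 : K) ∉ edgeIdeal K G ^ t := by
    by_contra! hall
    exact hfI (mem_of_forall_monomial_mem hall)
  have hX : ∀ w, X w * monomial a (1 : K) ∈ edgeIdeal K G ^ t := by
    intro w
    have h1 := (hf (X w)).1 (Ideal.subset_span ⟨w, rfl⟩)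
    have h2 := (isMonomialIdeal_edgeIdeal G).pow t _ h1 (Finsupp.single w 1 + a)
      (by rw [mem_support_iff, coeff_X_mul]; exact mem_support_iff.1 haf)
    simpa [X, monomial_mul] using h2
  have hne : ∀ v, a v ≠ 0 := fun v => by
    obtain ⟨p, hp⟩ := h v
    exact ne_zero_of_X_mul_monomial_mem hp ha hX
  obtain ⟨p, hp⟩ := h (Classical.arbitrary V)
  exact ha (Ideal.pow_le_pow_right ht
    (Ideal.mem_of_dvd _ (prod_X_dvd_monomial hne) (prod_X_mem_edgeIdeal_pow hp)))

theorem exists_monomial_idealOfVars_eq_colon {k : ℕ}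
    (h : ∀ v, ∃ p, G.IsCyclicWalk (2 * k + 1) v p) {t : ℕ} (ht : k + 1 ≤ t) {u v : V}
    (huv : G.Adj u v) :
    ∃ d : V →₀ ℕ, d.degree = 2 * t - 1 ∧
      (monomial d (1 : K) = (∏ w : V, X w) * (X u * X v) ^ (t - k - 1)) ∧
      idealOfVars V K = (edgeIdeal K G ^ t).colon {monomial d (1 : K)} := by
  have hcard : Fintype.card V = 2 * k + 1 := by
    obtain ⟨p, hp⟩ := h u
    -- The vertices are counted as a product of generators in `Multiplicative ℕ`.
    have := hp.prod_univ (M := Multiplicative ℕ) fun _ => Multiplicative.ofAdd 1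
    rw [Finset.prod_const, Finset.prod_const, Finset.card_range, Finset.card_univ,
      ← ofAdd_nsmul, ← ofAdd_nsmul] at this
    simpa only [smul_eq_mul, mul_one] using (Multiplicative.ofAdd.injective this).symm
  obtain ⟨d, hd⟩ : ∃ d : V →₀ ℕ, d = ∑ w, Finsupp.single w 1 +
    (t - k - 1) • (Finsupp.single u 1 + Finsupp.single v 1) := ⟨_, rfl⟩
  have hdeg : d.degree = 2 * t - 1 := by
    rw [hd]
    simp only [map_add, map_sum, map_nsmul, Finsupp.degree_single, Finset.sum_const,
      Finset.card_univ, hcard, smul_eq_mul]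
    omega
  have hmon : monomial d (1 : K) = (∏ w : V, X w) * (X u * X v) ^ (t - k - 1) := by
    have h1 : monomial (∑ w : V, Finsupp.single w 1) (1 : K) = ∏ w : V, X w :=
      monomial_sum_one _ _
    rw [← h1, X, X, monomial_mul, monomial_pow, monomial_mul, hd, one_mul, one_mul, one_pow]
  refine ⟨d, hdeg, hmon, idealOfVars_isMaximal.eq_of_le ?_ ?_⟩
  · rw [Ne, Ideal.eq_top_iff_one, Submodule.mem_colon_singleton, one_smul]
    intro hmem
    have := (monomial_mem_pow_idealOfVars_iff _ d (one_ne_zero (α := K))).1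
      (edgeIdeal_pow_le_idealOfVars_pow t hmem)
    omega
  · refine Ideal.span_le.2 ?_
    rintro _ ⟨w, rfl⟩
    obtain ⟨p, hp⟩ := h w
    rw [SetLike.mem_coe, Submodule.mem_colon_singleton, smul_eq_mul, hmon, ← mul_assoc,
      show t = (k + 1) + (t - k - 1) by omega, pow_add, show k + 1 + (t - k - 1) - k - 1 =
        t - k - 1 by omega]
    exact Ideal.mul_mem_mul (X_mul_prod_X_mem_edgeIdeal_pow hp)
      (Ideal.pow_mem_pow (X_mul_X_mem_edgeIdeal huv) _)

end OddCycle

theorem mainTheorem7 {K : Type*} [Field K] {V : Type*} [Fintype V] (G : SimpleGraph V)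
    (k : ℕ) (hk : 1 ≤ k) (hG : Nonempty (G ≃g SimpleGraph.cycleGraph (2 * k + 1))) :
    (∀ t : ℕ, 1 ≤ t → t ≤ k →
      associatedPrimes (MvPolynomial V K) (MvPolynomial V K ⧸ edgeIdeal K G ^ t) =
        (edgeIdeal K G).minimalPrimes) ∧
    (∀ t : ℕ, k + 1 ≤ t →
      associatedPrimes (MvPolynomial V K) (MvPolynomial V K ⧸ edgeIdeal K G ^ t) =
        (edgeIdeal K G).minimalPrimes ∪ {MvPolynomial.idealOfVars V K}) ∧
    (∀ t : ℕ, k + 1 ≤ t → ∀ u v : V, G.Adj u v →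
      ∃ d : V →₀ ℕ, d.degree = 2 * t - 1 ∧
        (MvPolynomial.monomial d (1 : K) =
          (∏ w : V, MvPolynomial.X w) *
            (MvPolynomial.X u * MvPolynomial.X v) ^ (t - k - 1)) ∧
        MvPolynomial.idealOfVars V K =
          (edgeIdeal K G ^ t).colon {MvPolynomial.monomial d (1 : K)}) := by
  obtain ⟨φ⟩ := hG
  have : Nonempty V := ⟨φ.symm 0⟩
  have hwalk : ∀ v, ∃ p, G.IsCyclicWalk (2 * k + 1) v p := by
    obtain ⟨j, rfl⟩ : ∃ j, k = j + 1 := ⟨k - 1, by omega⟩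
    exact G.exists_isCyclicWalk (n := 2 * j + 1) φ
  have hcolon : ∀ t : ℕ, k + 1 ≤ t → ∀ u v : V, G.Adj u v →
      ∃ d : V →₀ ℕ, d.degree = 2 * t - 1 ∧
        (MvPolynomial.monomial d (1 : K) =
          (∏ w : V, MvPolynomial.X w) *
            (MvPolynomial.X u * MvPolynomial.X v) ^ (t - k - 1)) ∧
        MvPolynomial.idealOfVars V K =
          (edgeIdeal K G ^ t).colon {MvPolynomial.monomial d (1 : K)} :=
    fun t ht u v huv => exists_monomial_idealOfVars_eq_colon hwalk ht huv
  refine ⟨fun t h1 ht => Set.Subset.antisymm (fun P hP => ?_) ?_,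
    fun t ht => Set.Subset.antisymm ?_ (Set.union_subset ?_ ?_), hcolon⟩
  · refine (associatedPrimes_edgeIdeal_pow_subset hwalk t hP).resolve_right ?_
    rintro rfl
    exact idealOfVars_notMem_associatedPrimes hwalk ht hP
  · exact minimalPrimes_subset_associatedPrimes_quotient_pow _ (by omega)
  · exact associatedPrimes_edgeIdeal_pow_subset hwalk t
  · exact minimalPrimes_subset_associatedPrimes_quotient_pow _ (by omega)
  · rw [Set.singleton_subset_iff]
    obtain ⟨p, hp⟩ := hwalk (φ.symm 0)
    obtain ⟨d, -, -, hd⟩ := hcolon t ht _ _ (hp.adj 0)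
    refine mem_associatedPrimes_quotient_iff.2 ⟨idealOfVars_isMaximal.isPrime,
      MvPolynomial.monomial d 1, fun r => ?_⟩
    rw [hd, Submodule.mem_colon_singleton, smul_eq_mul]
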